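/- Let $\mathcal X$ be a finite alphabet and let $X=(X_1,X_2,\dots)$ be a stationary ergodic source with letters in $\mathcal X$. Write $X^n=(X_1,\dots,X_n)$. Then the entropy rate $H(X)=\lim_{n\to\infty}\frac1n H(X^n)$ (Shannon entropy in bits) exists, and the following holds for every $\epsilon>0$ and every $\delta>0$ for all sufficiently large $n$, where the threshold for $n$ depends only on the source, $\epsilon$ and $\delta$. Let $\mathcal V$ be a finite alphabet, $d\ge 0$ an integer and $g:\mathcal X^n\to\mathcal V^d$ a deterministic injective target function, that is, a bijection onto its image (in particular, $g$ may be any bijection). Let $\mathcal Z$ be a finite non-empty embedding alphabet and $q\ge0$ an integer; put $\mathcal Q_z=\log_2|\mathcal Z|^q=q\log_2|\mathcal Z|$ and $\mathcal R=\mathcal Q_z/n$. Let $m\ge 0$ be an integer. A training set is a list $\Psi=((x_i,v_i))_{i=1}^m$ with $x_i\in\mathcal X^n$ and $v_i=g(x_i)$. A training procedure assigns to every training set $\Psi$ an encoder-decoder predictor $h_\Psi=\mathcal G\circ\mathcal F$ with $\mathcal F:\mathcal X^n\to\mathcal Z^q$ and $\mathcal G:\mathcal Z^q\to\mathcal V^d$.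 The probability of error is $P_e(h)=\Pr[h(X^n)\ne g(X^n)]$. The generalization error for a loss function $\ell:\mathcal V^d\times\mathcal V^d\to[0,1]$ with $\ell(v,v)=0$ for all $v$ is $\mathcal L_\ell(h)=\mathbb E[\ell(h(X^n),g(X^n))]$. (Achievability) If $\mathcal Q_z\ge n(H(X)+\epsilon)$, i.e. $\mathcal R\ge H(X)+\epsilon$, then there is a training procedure such that for every training set $\Psi$ one has $P_e(h_\Psi)\le\delta$, and $\mathcal L_\ell(h_\Psi)\le\delta$ for every such loss function $\ell$. That is, the probability of error and the generalization error can be made to tend to $0$ as $n\to\infty$. (Converse) If $\mathcal R<H(X)-\epsilon$, then for every training procedure and every training set $\Psi$ one has $P_e(h_\Psi)\ge1-\delta$. That is, the probability of error tends to $1$ as $n\to\infty$. -/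

import Mathlib

open MeasureTheory Filter Topology

noncomputable section

namespace EmbeddingRate

/-- The left shift on one-sided sequences. -/
def shift (S : Type*) : (ℕ → S) → (ℕ → S) := fun x i => x (i + 1)

/-- A stationary ergodic source: the letters `X 0, X 1, …` are random variables whose joint law on
the sequence space is invariant and ergodic under the shift. (The law of a two-sided stationary
ergodic process restricts to such a one-sided law.) -/
structure IsStationaryErgodic {Ω S : Type*} [MeasurableSpace Ω] [MeasurableSpace S]
    (P : Measure Ω) (X : ℕ → Ω → S) : Prop where
  measurable_letter : ∀ i, Measurable (X i)
  ergodic_shift : Ergodic (shift S) (P.map fun ω i => X i ω)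

/-- The random block consisting of the first `n` letters. -/
def block {Ω S : Type*} (X : ℕ → Ω → S) (n : ℕ) (ω : Ω) : Fin n → S := fun i => X i ω

/-- The probability mass function of the block of length `n`. -/
def blockProb {Ω S : Type*} [MeasurableSpace Ω] (P : Measure Ω) (X : ℕ → Ω → S) (n : ℕ)
    (x : Fin n → S) : ℝ :=
  P.real {ω | block X n ω = x}

/-- Shannon entropy, in bits, of the block of length `n`. -/
def blockEntropy {Ω S : Type*} [MeasurableSpace Ω] [Fintype S] (P : Measure Ω)
    (X : ℕ → Ω → S) (n : ℕ) : ℝ :=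
  -∑ x : Fin n → S, blockProb P X n x * Real.logb 2 (blockProb P X n x)

/-- Entropy rate, in bits per source symbol: the limit of the entropy of blocks per letter. -/
def entropyRate {Ω S : Type*} [MeasurableSpace Ω] [Fintype S] (P : Measure Ω)
    (X : ℕ → Ω → S) : ℝ :=
  limUnder atTop fun n : ℕ => blockEntropy P X n / n

/-- The bit budget `log₂ (|Z| ^ q)` of the embedding space `Z ^ q`. -/
def bitBudget (Z : Type*) [Fintype Z] (q : ℕ) : ℝ :=
  Real.logb 2 ((Fintype.card Z : ℝ) ^ q)

/-- The embedding representation rate, in bits per input symbol, for inputs of length `n`. -/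
def embeddingRate (Z : Type*) [Fintype Z] (q n : ℕ) : ℝ := bitBudget Z q / n

/-- A predictor that factors through the embedding space `Z ^ q`. -/
structure EncoderDecoder (S Z V : Type*) (n q d : ℕ) where
  encoder : (Fin n → S) → (Fin q → Z)
  decoder : (Fin q → Z) → (Fin d → V)

/-- The input-output map of an encoder-decoder predictor. -/
def EncoderDecoder.predict {S Z V : Type*} {n q d : ℕ} (h : EncoderDecoder S Z V n q d)
    (x : Fin n → S) : Fin d → V :=
  h.decoder (h.encoder x)

/-- Lists of `m` pairs of an input signal and an output signal. -/
abbrev SampleList (S V : Type*) (n d m : ℕ) := Fin m → (Fin n → S) × (Fin d → V)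

/-- A training set labelled by the target function `g`. -/
def IsTrainingSet {S V : Type*} {n d m : ℕ} (g : (Fin n → S) → (Fin d → V))
    (Ψ : SampleList S V n d m) : Prop :=
  ∀ i, (Ψ i).2 = g (Ψ i).1

/-- A training procedure returns an encoder-decoder predictor for every list of samples. -/
abbrev Trainer (S Z V : Type*) (n q d m : ℕ) :=
  SampleList S V n d m → EncoderDecoder S Z V n q d

/-- The probability that the predictor errs on a fresh input block with target `g`. -/
def errorProb {Ω S Z V : Type*} [MeasurableSpace Ω] (P : Measure Ω) (X : ℕ → Ω → S)
    {n q d : ℕ} (g : (Fin n → S) → (Fin d → V)) (h : EncoderDecoder S Z V n q d) : ℝ :=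
  P.real {ω | h.predict (block X n ω) ≠ g (block X n ω)}

/-- A loss function with values in `[0, 1]` that vanishes at correct predictions. -/
structure IsLoss {W : Type*} (l : W → W → ℝ) : Prop where
  nonneg : ∀ w v, 0 ≤ l w v
  le_one : ∀ w v, l w v ≤ 1
  self : ∀ v, l v v = 0

/-- The generalization error: the expected loss on a fresh input block with target `g`. -/
def generalizationError {Ω S Z V : Type*} [MeasurableSpace Ω] (P : Measure Ω) (X : ℕ → Ω → S)
    {n q d : ℕ} (l : (Fin d → V) → (Fin d → V) → ℝ) (g : (Fin n → S) → (Fin d → V))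
    (h : EncoderDecoder S Z V n q d) : ℝ :=
  ∫ ω, l (h.predict (block X n ω)) (g (block X n ω)) ∂P

end EmbeddingRate

end

open EmbeddingRate

/-!
Everything reduces to the following: for a stationary ergodic law `μ` on sequences with entropy rate
`H`, about `2 ^ (n H)` words of length `n` carry almost all the probability
(`exists_finset_card_le`), and exponentially smaller sets carry almost none
(`measureReal_le_of_card_le`). For achievability, the encoder numbers the words of the large set
and the decoder applies the target to the numbered word; no sample is needed. For the converse, an
injective target is predicted correctly on at most as many words as there are embeddings.

Block entropies are subadditive by Gibbs' inequality, so the rate exists by Fekete's lemma, and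
`n H` is at most the entropy of the block of length `n`. Both facts about words follow from this and
from one half of the Shannon–McMillan theorem (`exists_subprobability_eventually_large`). Choose
`k` such that the increment `H(k + 1) - H(k)` of block entropies is at most `H + ε`. The Markov
approximation of `μ` of order `k` is a subprobability on words of any length, and minus its
logarithm along a sequence is, up to a bounded term, a Birkhoff sum of a bounded function with mean
`H(k + 1) - H(k)`. By the mean ergodic theorem, the approximation gives weight at least about
`2 ^ (-n (H + ε))` to the block, up to small probability, and at most `2 ^ (n (H + ε))` words can
have that weight.

The other half needs no martingale argument: if a set `B` of at most `2 ^ (n (H - ε))` words had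
probability `b`, then coding words in `B` with `n (H - ε)` bits, other words of large weight with
`n (H + ε')` bits and the improbable rest with `n log₂ |S|` bits would give an average length close
to `n (H + ε' - b ε)`, and by Gibbs' inequality this is at least the block entropy, hence at least
`n H`.
-/

namespace EmbeddingRate

/-! ### The mean ergodic theorem in probability -/

/-- The mean ergodic theorem in probability: the orthogonal projection in von Neumann's theorem is
the expectation, because invariant functions are constant and the projection fixes the inner product
with the constant `1`. -/
theorem tendsto_measureReal_birkhoffAverage_sub {α : Type*} [MeasurableSpace α] {μ : Measure α}
    [IsProbabilityMeasure μ] {T : α → α} (hT : Ergodic T μ) {f : α → ℝ} (hf : MemLp f 2 μ)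
    {ε : ℝ} (hε : 0 < ε) :
    Tendsto (fun n : ℕ => μ.real {w | ε ≤ |birkhoffAverage ℝ T f n w - ∫ a, f a ∂μ|})
      atTop (𝓝 0) := by
  have hT' : MeasurePreserving T μ μ := hT.toMeasurePreserving
  set U : Lp ℝ 2 μ →L[ℝ] Lp ℝ 2 μ :=
    (Lp.compMeasurePreservingₗᵢ ℝ T hT').toContinuousLinearMap with hU
  have hU1 : ‖U‖ ≤ 1 := LinearIsometry.norm_toContinuousLinearMap_le _
  set F : Lp ℝ 2 μ := hf.toLp f with hF
  have hlim := U.tendsto_birkhoffAverage_orthogonalProjection hU1 F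
  set K := U.eqLocus (1 : Lp ℝ 2 μ →L[ℝ] Lp ℝ 2 μ) with hK
  set L : Lp ℝ 2 μ := (K.orthogonalProjectionOnto F : Lp ℝ 2 μ) with hL
  have hLmem : L ∈ K := (K.orthogonalProjectionOnto F).2
  have hLfix : U L = L := by simpa [hK] using hLmem
  have hLinv : L ∘ T =ᵐ[μ] L := by
    have h1 : (U L : α → ℝ) =ᵐ[μ] L ∘ T := Lp.coeFn_compMeasurePreserving L hT'
    rw [hLfix] at h1
    exact h1.symm
  obtain ⟨c, hc⟩ := hT.ae_eq_const_of_ae_eq_comp_ae (Lp.aestronglyMeasurable L) hLinv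
  have h1L : MemLp (fun _ : α => (1 : ℝ)) 2 μ := memLp_const 1
  set one : Lp ℝ 2 μ := h1L.toLp _ with hone
  have honeK : one ∈ K := by
    have : U one = one := rfl
    simpa [hK] using this
  have hcint : c = ∫ a, f a ∂μ := by
    have h := K.inner_orthogonalProjectionOnto_eq_of_mem_right ⟨one, honeK⟩ F
    change inner ℝ L one = inner ℝ F one at h
    rw [L2.inner_def, L2.inner_def] at h
    have e1 : ∫ a, inner ℝ (L a) (one a) ∂μ = c := by
      rw [integral_congr_ae (g := fun _ => c)]
      · simp
      · filter_upwards [hc] with a ha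
        simp [hone, ha]
    have e2 : ∫ a, inner ℝ (F a) (one a) ∂μ = ∫ a, f a ∂μ := by
      refine integral_congr_ae ?_
      filter_upwards [hf.coeFn_toLp] with a ha
      simp [hone, hF, ha]
    rw [← e1, h, e2]
  have havg : ∀ n : ℕ, ((birkhoffAverage ℝ U _root_.id n F : Lp ℝ 2 μ) : α → ℝ)
      =ᵐ[μ] birkhoffAverage ℝ T f n := by
    intro n
    have hiter : ∀ i : ℕ, ((U^[i] F : Lp ℝ 2 μ) : α → ℝ) =ᵐ[μ] f ∘ T^[i] := by
      intro i
      have h : U^[i] F = Lp.compMeasurePreserving T^[i] (hT'.iterate i) F := by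
        rw [← Lp.compMeasurePreserving_iterate hT' i]; rfl
      rw [h, hF, Lp.toLp_compMeasurePreserving]
      exact MemLp.coeFn_toLp _
    have hsum : ∀ m : ℕ, ((birkhoffSum U _root_.id m F : Lp ℝ 2 μ) : α → ℝ)
        =ᵐ[μ] birkhoffSum T f m := by
      intro m
      induction m with
      | zero =>
        simp only [birkhoffSum_zero]
        exact (Lp.coeFn_zero ℝ 2 μ).trans (ae_of_all _ fun a => by simp [birkhoffSum_zero])
      | succ m ih =>
        rw [birkhoffSum_succ]
        filter_upwards [Lp.coeFn_add (birkhoffSum U _root_.id m F) (_root_.id (U^[m] F)), ih,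
          hiter m] with a h1 h2 h3
        rw [h1, birkhoffSum_succ, Pi.add_apply, h2]
        simpa using h3
    simp only [birkhoffAverage]
    filter_upwards [Lp.coeFn_smul ((n : ℝ)⁻¹) (birkhoffSum U _root_.id n F), hsum n] with a h1 h2
    rw [h1, Pi.smul_apply, h2, birkhoffAverage]
  have hmeas := tendstoInMeasure_of_tendsto_Lp hlim
  rw [tendstoInMeasure_iff_dist] at hmeas
  have h0 := hmeas ε hε
  rw [← ENNReal.toReal_zero]
  refine ((ENNReal.tendsto_toReal ENNReal.zero_ne_top).comp h0).congr fun n => ?_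
  simp only [Function.comp, measureReal_def]
  congr 1
  refine measure_congr ?_
  filter_upwards [havg n, hc] with a ha hca
  refine propext ?_
  change ε ≤ dist _ _ ↔ ε ≤ |_|
  rw [ha, hca, Real.dist_eq, Function.const_apply, hcint]

/-! ### Gibbs' inequality -/

/-- **Gibbs' inequality** in bits. Where `p` vanishes, `r` is allowed to vanish as well. -/
theorem neg_sum_mul_logb_le {ι : Type*} [Fintype ι] {p r : ι → ℝ} (hp : ∀ i, 0 ≤ p i)
    (hr : ∀ i, 0 ≤ r i) (hsum : ∑ i, r i ≤ ∑ i, p i) (hac : ∀ i, p i ≠ 0 → r i ≠ 0) :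
    -∑ i, p i * Real.logb 2 (p i) ≤ -∑ i, p i * Real.logb 2 (r i) := by
  have hlog2 : 0 < Real.log 2 := Real.log_pos one_lt_two
  have hterm : ∀ i, p i * Real.log (r i) - p i * Real.log (p i) ≤ r i - p i := by
    intro i
    rcases (hp i).eq_or_lt with h0 | hpos
    · simp [← h0, hr i]
    · have hrpos : 0 < r i := (hr i).lt_of_ne (hac i hpos.ne').symm
      have h := Real.log_le_sub_one_of_pos (div_pos hrpos hpos)
      rw [Real.log_div hrpos.ne' hpos.ne'] at h
      have h2 := mul_le_mul_of_nonneg_left h hpos.le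
      have h3 : p i * (r i / p i - 1) = r i - p i := by field_simp
      linarith
  have hs : ∑ i, (p i * Real.log (r i) - p i * Real.log (p i)) ≤ 0 := by
    refine (Finset.sum_le_sum fun i _ => hterm i).trans ?_
    rw [Finset.sum_sub_distrib]; linarith
  rw [Finset.sum_sub_distrib] at hs
  simp only [Real.logb, mul_div_assoc', ← Finset.sum_div]
  rw [neg_le_neg_iff]
  exact div_le_div_of_nonneg_right (by linarith) hlog2.le

/-! ### Blocks and their probabilities -/

/-- The letters of a sequence, as random variables on the sequence space. -/
abbrev letter (S : Type*) : ℕ → (ℕ → S) → S := fun i w => w i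

theorem measurable_block {Ω S : Type*} [MeasurableSpace Ω] [MeasurableSpace S] {X : ℕ → Ω → S}
    (hX : ∀ i, Measurable (X i)) (n : ℕ) : Measurable (block X n) :=
  measurable_pi_lambda _ fun i => hX i

theorem measurable_block_letter {S : Type*} [MeasurableSpace S] (n : ℕ) :
    Measurable (block (letter S) n) :=
  measurable_block (fun i => measurable_pi_apply i) n

theorem blockProb_nonneg {S : Type*} [MeasurableSpace S] {μ : Measure (ℕ → S)} (n : ℕ)
    (x : Fin n → S) : 0 ≤ blockProb μ (letter S) n x :=
  measureReal_nonneg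

theorem blockProb_le_one {S : Type*} [MeasurableSpace S] {μ : Measure (ℕ → S)}
    [IsProbabilityMeasure μ] (n : ℕ) (x : Fin n → S) : blockProb μ (letter S) n x ≤ 1 :=
  measureReal_le_one

theorem blockEntropy_nonneg {S : Type*} [Fintype S] [MeasurableSpace S] {μ : Measure (ℕ → S)}
    [IsProbabilityMeasure μ] (n : ℕ) : 0 ≤ blockEntropy μ (letter S) n := by
  rw [blockEntropy, neg_nonneg]
  exact Finset.sum_nonpos fun x _ => mul_nonpos_of_nonneg_of_nonpos (blockProb_nonneg n x)
    (Real.logb_nonpos one_lt_two (blockProb_nonneg n x) (blockProb_le_one n x))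

theorem bddBelow_blockEntropy_div {S : Type*} [Fintype S] [MeasurableSpace S]
    {μ : Measure (ℕ → S)} [IsProbabilityMeasure μ] :
    BddBelow (Set.range fun n : ℕ => blockEntropy μ (letter S) n / n) :=
  ⟨0, by rintro _ ⟨n, rfl⟩; exact div_nonneg (blockEntropy_nonneg n) n.cast_nonneg⟩

theorem blockProb_eq_shift_iterate {S : Type*} [Countable S] [MeasurableSpace S]
    [MeasurableSingletonClass S] {μ : Measure (ℕ → S)} (hμ : MeasurePreserving (shift S) μ μ)
    (m n : ℕ) (x : Fin n → S) : blockProb μ (letter S) n x =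
      μ.real {w | block (letter S) n ((shift S)^[m] w) = x} :=
  ((hμ.iterate m).measureReal_preimage (s := {w | block (letter S) n w = x})
    (measurable_block_letter n (measurableSet_singleton x)).nullMeasurableSet).symm

theorem shift_iterate_apply {S : Type*} (m : ℕ) (w : ℕ → S) (i : ℕ) :
    (shift S)^[m] w i = w (m + i) := by
  induction m generalizing w with
  | zero => simp
  | succ m ih => rw [Function.iterate_succ_apply, ih]; simp [shift]; congr 1; omega

theorem block_shift_iterate {S : Type*} (m n : ℕ) (w : ℕ → S) :
    block (letter S) n ((shift S)^[m] w) =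
      fun i => block (letter S) (m + n) w (Fin.natAdd m i) := by
  funext i
  simp [block, shift_iterate_apply]

section Transfer

variable {Ω S : Type*} [MeasurableSpace Ω] [Fintype S] [MeasurableSpace S]
  [MeasurableSingletonClass S] {P : Measure Ω} {X : ℕ → Ω → S}

/-- Events about a block have the same probability for the source and for its law on sequences. -/
theorem measureReal_block_eq_map (hX : ∀ i, Measurable (X i)) (n : ℕ) (p : (Fin n → S) → Prop) :
    P.real {ω | p (block X n ω)} =
      (P.map fun ω i => X i ω).real {w | p (block (letter S) n w)} := by
  rw [map_measureReal_apply (measurable_pi_lambda _ hX)]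
  · rfl
  · exact measurable_block (fun i => measurable_pi_apply i) n (Set.toFinite {x | p x}).measurableSet

theorem blockProb_eq_map (hX : ∀ i, Measurable (X i)) (n : ℕ) :
    blockProb P X n = blockProb (P.map fun ω i => X i ω) (letter S) n :=
  funext fun x => measureReal_block_eq_map hX n (· = x)

theorem blockEntropy_eq_map (hX : ∀ i, Measurable (X i)) (n : ℕ) :
    blockEntropy P X n = blockEntropy (P.map fun ω i => X i ω) (letter S) n := by
  simp only [blockEntropy, blockProb_eq_map hX]

end Transfer

section Law

variable {S : Type*} [Fintype S] [MeasurableSpace S] [MeasurableSingletonClass S]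
  {μ : Measure (ℕ → S)}

theorem measurable_comp_block (n : ℕ) {β : Type*} [MeasurableSpace β] (F : (Fin n → S) → β) :
    Measurable fun w => F (block (letter S) n w) :=
  (Measurable.of_discrete (f := F)).comp (measurable_block_letter n)

theorem integral_comp_block_shift (hμ : MeasurePreserving (shift S) μ μ) (m n : ℕ)
    (F : (Fin n → S) → ℝ) :
    ∫ w, F (block (letter S) n ((shift S)^[m] w)) ∂μ = ∫ w, F (block (letter S) n w) ∂μ := by
  have h := (hμ.iterate m)
  conv_rhs => rw [← h.map_eq]
  rw [integral_map h.measurable.aemeasurable]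
  exact (measurable_comp_block n F).aestronglyMeasurable

variable [IsProbabilityMeasure μ]

theorem integral_comp_block (n : ℕ) (F : (Fin n → S) → ℝ) :
    ∫ w, F (block (letter S) n w) ∂μ = ∑ x, blockProb μ (letter S) n x * F x := by
  rw [← integral_map (measurable_block_letter n).aemeasurable
    (Measurable.of_discrete (f := F)).aestronglyMeasurable]
  have := Measure.isProbabilityMeasure_map (μ := μ)
    (measurable_block_letter (S := S) n).aemeasurable
  rw [integral_fintype (Integrable.of_finite)]
  refine Finset.sum_congr rfl fun x _ => ?_
  rw [map_measureReal_apply (measurable_block_letter n) (measurableSet_singleton x)]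
  rfl

theorem sum_blockProb (n : ℕ) : ∑ x, blockProb μ (letter S) n x = 1 := by
  have h := integral_comp_block (μ := μ) n (fun _ : Fin n → S => (1 : ℝ))
  simpa using h.symm

theorem measureReal_comp_block (n : ℕ) (B : Finset (Fin n → S)) :
    μ.real {w | block (letter S) n w ∈ B} = ∑ x ∈ B, blockProb μ (letter S) n x := by
  classical
  have h := integral_comp_block (μ := μ) n (Set.indicator (B : Set (Fin n → S)) fun _ => (1 : ℝ))
  have hm : MeasurableSet {w | block (letter S) n w ∈ B} :=
    measurable_block_letter n B.measurableSet
  have e : ∀ w, Set.indicator (B : Set (Fin n → S)) (fun _ => (1 : ℝ)) (block (letter S) n w)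
      = Set.indicator {w | block (letter S) n w ∈ B} 1 w := fun w => rfl
  simp only [e, integral_indicator_one hm] at h
  rw [h]
  simp [Set.indicator_apply]

theorem blockEntropy_eq_integral (n : ℕ) :
    blockEntropy μ (letter S) n =
      ∫ w, -Real.logb 2 (blockProb μ (letter S) n (block (letter S) n w)) ∂μ := by
  rw [integral_comp_block n fun x => -Real.logb 2 (blockProb μ (letter S) n x), blockEntropy]
  simp

theorem blockProb_block_ne_zero (n : ℕ) :
    ∀ᵐ w ∂μ, blockProb μ (letter S) n (block (letter S) n w) ≠ 0 := by
  have h := measureReal_comp_block (μ := μ) n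
    (Finset.univ.filter fun x => blockProb μ (letter S) n x = 0)
  rw [Finset.sum_eq_zero (fun x hx => (Finset.mem_filter.1 hx).2), measureReal_eq_zero_iff] at h
  simpa [ae_iff] using h

theorem integrable_comp_block (n : ℕ) (F : (Fin n → S) → ℝ) :
    Integrable (fun w => F (block (letter S) n w)) μ :=
  Integrable.of_bound (measurable_comp_block n F).aestronglyMeasurable (∑ x, |F x|)
    (ae_of_all _ fun _ => Finset.single_le_sum (f := fun x => |F x|) (fun _ _ => abs_nonneg _)
      (Finset.mem_univ _))

/-! ### Subadditivity of block entropies and the entropy rate -/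

/-- Gibbs' inequality for the product of the marginals of two consecutive blocks. -/
theorem subadditive_blockEntropy (hμ : MeasurePreserving (shift S) μ μ) :
    Subadditive (blockEntropy μ (letter S)) := by
  intro m n
  set p := fun n => blockProb μ (letter S) n with hp
  let r : (Fin (m + n) → S) → ℝ :=
    fun x => p m (fun i => x (Fin.castAdd n i)) * p n (fun i => x (Fin.natAdd m i))
  have hle1 : ∀ x, p (m + n) x ≤ p m (fun i => x (Fin.castAdd n i)) := fun x =>
    measureReal_mono fun w hw => by
      simp only [Set.mem_ofPred_eq] at hw ⊢
      rw [← hw]; rfl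
  have hle2 : ∀ x, p (m + n) x ≤ p n (fun i => x (Fin.natAdd m i)) := fun x => by
    simp only [hp]
    rw [blockProb_eq_shift_iterate hμ m n]
    exact measureReal_mono fun w hw => by
      simp only [Set.mem_ofPred_eq] at hw ⊢
      rw [← hw, block_shift_iterate]
  have hpos : ∀ x, p (m + n) x ≠ 0 → p m (fun i => x (Fin.castAdd n i)) ≠ 0 ∧
      p n (fun i => x (Fin.natAdd m i)) ≠ 0 := fun x hx => by
    have h0 : 0 < p (m + n) x := (blockProb_nonneg _ x).lt_of_ne hx.symm
    exact ⟨(h0.trans_le (hle1 x)).ne', (h0.trans_le (hle2 x)).ne'⟩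
  have hsum : ∑ x, r x = 1 := by
    rw [← (Fin.appendEquiv (α := S) m n).sum_comp, Fintype.sum_prod_type]
    simp only [r, Fin.appendEquiv, Equiv.coe_fn_mk, Fin.append_left, Fin.append_right]
    change ∑ x, ∑ y, blockProb μ (letter S) m x * blockProb μ (letter S) n y = 1
    simp only [← Finset.mul_sum, sum_blockProb, mul_one]
  have hG := neg_sum_mul_logb_le (p := p (m + n)) (r := r) (fun x => blockProb_nonneg _ x)
    (fun x => mul_nonneg (blockProb_nonneg _ _) (blockProb_nonneg _ _))
    (by rw [hsum]; exact (sum_blockProb (m + n)).ge)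
    (fun x hx => mul_ne_zero (hpos x hx).1 (hpos x hx).2)
  refine hG.trans (le_of_eq ?_)
  have hsplit : ∀ x, p (m + n) x * Real.logb 2 (r x) =
      p (m + n) x * Real.logb 2 (p m (fun i => x (Fin.castAdd n i))) +
      p (m + n) x * Real.logb 2 (p n (fun i => x (Fin.natAdd m i))) := fun x => by
    by_cases hx : p (m + n) x = 0
    · simp [hx]
    · rw [Real.logb_mul (hpos x hx).1 (hpos x hx).2, mul_add]
  simp only [hsplit, Finset.sum_add_distrib]
  rw [← integral_comp_block (m + n) fun x => Real.logb 2 (p m (fun i => x (Fin.castAdd n i))),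
    ← integral_comp_block (m + n) fun x => Real.logb 2 (p n (fun i => x (Fin.natAdd m i))),
    neg_add, blockEntropy_eq_integral, blockEntropy_eq_integral, integral_neg, integral_neg,
    ← integral_comp_block_shift hμ m n fun x => Real.logb 2 (blockProb μ (letter S) n x)]
  simp only [block_shift_iterate]
  rfl

theorem tendsto_blockEntropy_div (hμ : MeasurePreserving (shift S) μ μ) :
    Tendsto (fun n : ℕ => blockEntropy μ (letter S) n / n) atTop
      (𝓝 (entropyRate μ (letter S))) :=
  tendsto_nhds_limUnder
    ⟨_, (subadditive_blockEntropy hμ).tendsto_lim bddBelow_blockEntropy_div⟩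

theorem entropyRate_nonneg (hμ : MeasurePreserving (shift S) μ μ) :
    0 ≤ entropyRate μ (letter S) :=
  ge_of_tendsto' (tendsto_blockEntropy_div hμ) fun n =>
    div_nonneg (blockEntropy_nonneg n) n.cast_nonneg

theorem mul_entropyRate_le_blockEntropy (hμ : MeasurePreserving (shift S) μ μ) (n : ℕ) :
    n * entropyRate μ (letter S) ≤ blockEntropy μ (letter S) n := by
  have hs := subadditive_blockEntropy hμ
  have heq : entropyRate μ (letter S) = hs.lim :=
    tendsto_nhds_unique (tendsto_blockEntropy_div hμ) (hs.tendsto_lim bddBelow_blockEntropy_div)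
  rcases Nat.eq_zero_or_pos n with rfl | hn
  · simpa using blockEntropy_nonneg 0
  · have h := hs.lim_le_div bddBelow_blockEntropy_div hn.ne'
    rw [← heq, le_div_iff₀ (by exact_mod_cast hn)] at h
    linarith

/-- Some entropy increment is close to the entropy rate, since the rate is the limit of the averages
of the increments. -/
theorem exists_blockEntropy_succ_sub_lt (hμ : MeasurePreserving (shift S) μ μ) {ε : ℝ}
    (hε : 0 < ε) : ∃ k, blockEntropy μ (letter S) (k + 1) - blockEntropy μ (letter S) k <
      entropyRate μ (letter S) + ε := by
  by_contra! h
  have hge : ∀ n : ℕ, n * (entropyRate μ (letter S) + ε) ≤ blockEntropy μ (letter S) n := by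
    intro n
    induction n with
    | zero => simpa using blockEntropy_nonneg 0
    | succ n ih => have := h n; push_cast; linarith
  have : entropyRate μ (letter S) + ε ≤ entropyRate μ (letter S) := by
    refine ge_of_tendsto (tendsto_blockEntropy_div hμ) ?_
    filter_upwards [eventually_gt_atTop 0] with n hn
    rw [le_div_iff₀ (by exact_mod_cast hn)]
    linarith [hge n]
  linarith

end Law

/-! ### Markov approximations -/

section Markov

variable {S : Type*} [MeasurableSpace S]

/-- The conditional probability of the first letter of a word of length `k + 1` given the `k`
letters after it. It is `0` when those have probability `0`. -/
noncomputable def backwardTransition (μ : Measure (ℕ → S)) (k : ℕ) (x : Fin (k + 1) → S) : ℝ :=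
  blockProb μ (letter S) (k + 1) x / blockProb μ (letter S) k (Fin.tail x)

/-- The probability of a word of length `k + j` under the Markov approximation of order `k`. The
word is read backwards: its last `k` letters are drawn from `μ`, and every earlier letter is drawn
given the `k` letters after it, so that the recursion removes the first letter, as the shift does. -/
noncomputable def markovProb (μ : Measure (ℕ → S)) (k : ℕ) : (j : ℕ) → (Fin (k + j) → S) → ℝ
  | 0, x => blockProb μ (letter S) k x
  | j + 1, x =>
    backwardTransition μ k (fun i => x (Fin.castLE (by omega) i)) *
      markovProb μ k j (Fin.tail (n := k + j) x)

/-- The information, in bits, carried by the first letter given the next `k`. -/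
noncomputable def transitionInfo (μ : Measure (ℕ → S)) (k : ℕ) (w : ℕ → S) : ℝ :=
  -Real.logb 2 (backwardTransition μ k (block (letter S) (k + 1) w))

variable {μ : Measure (ℕ → S)}

theorem backwardTransition_nonneg (k : ℕ) (x : Fin (k + 1) → S) : 0 ≤ backwardTransition μ k x :=
  div_nonneg (blockProb_nonneg _ _) (blockProb_nonneg _ _)

theorem markovProb_nonneg (k j : ℕ) (x : Fin (k + j) → S) : 0 ≤ markovProb μ k j x := by
  induction j with
  | zero => exact blockProb_nonneg _ _
  | succ j ih => exact mul_nonneg (backwardTransition_nonneg _ _) (ih _)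

theorem markovProb_block_succ (k j : ℕ) (w : ℕ → S) :
    markovProb μ k (j + 1) (block (letter S) (k + (j + 1)) w) =
      backwardTransition μ k (block (letter S) (k + 1) w) *
        markovProb μ k j (block (letter S) (k + j) (shift S w)) :=
  rfl

theorem backwardTransition_block (k : ℕ) (w : ℕ → S) :
    backwardTransition μ k (block (letter S) (k + 1) w) =
      blockProb μ (letter S) (k + 1) (block (letter S) (k + 1) w) /
        blockProb μ (letter S) k (block (letter S) k (shift S w)) :=
  rfl

/-- Along a sequence all of whose blocks have positive probability, the logarithm of the Markov
approximation is a Birkhoff sum up to one term. -/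
theorem neg_logb_markovProb (k j : ℕ) (w : ℕ → S)
    (hw : ∀ n i, blockProb μ (letter S) n (block (letter S) n ((shift S)^[i] w)) ≠ 0) :
    markovProb μ k j (block (letter S) (k + j) w) ≠ 0 ∧
    -Real.logb 2 (markovProb μ k j (block (letter S) (k + j) w)) =
      birkhoffSum (shift S) (transitionInfo μ k) j w -
        Real.logb 2 (blockProb μ (letter S) k (block (letter S) k ((shift S)^[j] w))) := by
  induction j generalizing w with
  | zero => exact ⟨hw k 0, by simp [markovProb, birkhoffSum_zero]⟩
  | succ j ih =>
    obtain ⟨h1, h2⟩ := ih (shift S w) fun n i => by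
      simpa only [← Function.iterate_succ_apply] using hw n (i + 1)
    have h3 : backwardTransition μ k (block (letter S) (k + 1) w) ≠ 0 := by
      rw [backwardTransition_block]
      exact div_ne_zero (hw (k + 1) 0) (hw k 1)
    rw [markovProb_block_succ]
    refine ⟨mul_ne_zero h3 h1, ?_⟩
    rw [Real.logb_mul h3 h1, birkhoffSum_succ', Function.iterate_succ_apply, neg_add, h2,
      transitionInfo]
    ring

variable [Fintype S] [MeasurableSingletonClass S] [IsProbabilityMeasure μ]

theorem sum_blockProb_cons (hμ : MeasurePreserving (shift S) μ μ) (k : ℕ) (z : Fin k → S) :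
    ∑ a, blockProb μ (letter S) (k + 1) (Fin.cons a z) = blockProb μ (letter S) k z := by
  classical
  rw [blockProb_eq_shift_iterate hμ 1]
  have hset : {w : ℕ → S | block (letter S) k ((shift S)^[1] w) = z} =
      {w | block (letter S) (k + 1) w ∈
        Finset.univ.image fun a : S => (Fin.cons a z : Fin (k + 1) → S)} := by
    ext w
    have htail : block (letter S) k ((shift S)^[1] w) = Fin.tail (block (letter S) (k + 1) w) := rfl
    simp only [Set.mem_ofPred_eq, Finset.mem_image, Finset.mem_univ, true_and, htail]
    constructor
    · rintro rfl
      exact ⟨_, Fin.cons_self_tail _⟩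
    · rintro ⟨a, ha⟩
      rw [← ha, Fin.tail_cons]
  rw [hset, measureReal_comp_block, Finset.sum_image]
  intro a _ b _ hab
  exact (Fin.cons_injective2 hab).1

theorem sum_markovProb_le_one (hμ : MeasurePreserving (shift S) μ μ) (k j : ℕ) :
    ∑ x, markovProb μ k j x ≤ 1 := by
  induction j with
  | zero => exact (sum_blockProb k).le
  | succ j ih =>
    refine le_trans ?_ ih
    change ∑ x : Fin (k + j + 1) → S, _ ≤ _
    rw [← (Fin.consEquiv fun _ => S).sum_comp, Fintype.sum_prod_type_right]
    refine Finset.sum_le_sum fun y _ => ?_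
    set z : Fin k → S := fun i => y (Fin.castAdd j i) with hz
    have hval : ∀ a : S,
        markovProb μ k (j + 1) (Fin.consEquiv (fun _ : Fin (k + j + 1) => S) (a, y)) =
        blockProb μ (letter S) (k + 1) (Fin.cons a z) / blockProb μ (letter S) k z *
          markovProb μ k j y := by
      intro a
      have hpre : (fun i : Fin (k + 1) =>
          (Fin.cons a y : Fin (k + j + 1) → S) (Fin.castLE (by omega) i)) = Fin.cons a z := by
        funext i
        refine Fin.cases rfl (fun i => rfl) i
      change backwardTransition μ k (fun i : Fin (k + 1) =>
          (Fin.cons a y : Fin (k + j + 1) → S) (Fin.castLE (by omega) i)) *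
        markovProb μ k j (Fin.tail (Fin.cons a y : Fin (k + j + 1) → S)) = _
      rw [hpre, Fin.tail_cons, backwardTransition, Fin.tail_cons]
    simp only [hval]
    rw [← Finset.sum_mul, ← Finset.sum_div, sum_blockProb_cons hμ]
    exact mul_le_of_le_one_left (markovProb_nonneg k j y) (div_self_le_one _)

theorem integral_transitionInfo (hμ : MeasurePreserving (shift S) μ μ) (k : ℕ) :
    ∫ w, transitionInfo μ k w ∂μ =
      blockEntropy μ (letter S) (k + 1) - blockEntropy μ (letter S) k := by
  rw [blockEntropy_eq_integral, blockEntropy_eq_integral,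
    ← integral_comp_block_shift hμ 1 k fun x => -Real.logb 2 (blockProb μ (letter S) k x)]
  have h1 := integrable_comp_block (μ := μ) (k + 1) fun x =>
    -Real.logb 2 (blockProb μ (letter S) (k + 1) x)
  have h2 : Integrable (fun w => -Real.logb 2 (blockProb μ (letter S) k
      (block (letter S) k ((shift S)^[1] w)))) μ :=
    (hμ.iterate 1).integrable_comp_of_integrable (integrable_comp_block k fun x =>
      -Real.logb 2 (blockProb μ (letter S) k x))
  rw [← integral_sub h1 h2]
  refine integral_congr_ae ?_
  filter_upwards [blockProb_block_ne_zero (μ := μ) (k + 1),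
    hμ.quasiMeasurePreserving.ae (blockProb_block_ne_zero (μ := μ) k)] with w h1 h2
  rw [transitionInfo, backwardTransition_block, Real.logb_div h1 h2, Function.iterate_one]
  ring

theorem memLp_transitionInfo (k : ℕ) : MemLp (transitionInfo μ k) 2 μ := by
  let F : (Fin (k + 1) → S) → ℝ := fun x => -Real.logb 2 (backwardTransition μ k x)
  exact MemLp.of_bound (measurable_comp_block (k + 1) F).aestronglyMeasurable (∑ x, |F x|)
    (ae_of_all _ fun w => Finset.single_le_sum (f := fun x => |F x|) (fun _ _ => abs_nonneg _)
      (Finset.mem_univ _))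

theorem ae_blockProb_block_shift_iterate_ne_zero (hμ : MeasurePreserving (shift S) μ μ) :
    ∀ᵐ w ∂μ, ∀ n i, blockProb μ (letter S) n (block (letter S) n ((shift S)^[i] w)) ≠ 0 := by
  rw [ae_all_iff]; intro n
  rw [ae_all_iff]; intro i
  exact (hμ.iterate i).quasiMeasurePreserving.ae (blockProb_block_ne_zero n)

/-- The half of the asymptotic equipartition property that bounds information from above: up to
small probability, blocks have weight at least `2 ^ (-n (H + ε))` under a subprobability. -/
theorem exists_subprobability_eventually_large (hμ : Ergodic (shift S) μ) {ε δ : ℝ} (hε : 0 < ε)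
    (hδ : 0 < δ) : ∃ N : ℕ, ∀ n, N ≤ n → ∃ r : (Fin n → S) → ℝ, (∀ x, 0 ≤ r x) ∧ ∑ x, r x ≤ 1 ∧
      μ.real {w | r (block (letter S) n w) < 2 ^ (-(n * (entropyRate μ (letter S) + ε)))} ≤ δ := by
  have hmp := hμ.toMeasurePreserving
  set H := entropyRate μ (letter S) with hH
  have hH0 : 0 ≤ H := entropyRate_nonneg hmp
  obtain ⟨k, hk⟩ := exists_blockEntropy_succ_sub_lt hmp (half_pos (half_pos hε))
  rw [← integral_transitionInfo hmp] at hk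
  set C : ℝ := ∑ x, |Real.logb 2 (blockProb μ (letter S) k x)| with hC
  have hlim := tendsto_measureReal_birkhoffAverage_sub hμ (memLp_transitionInfo k)
    (half_pos (half_pos hε))
  obtain ⟨N₁, hN₁⟩ := eventually_atTop.1 (hlim.eventually_le_const hδ)
  obtain ⟨N₂, hN₂⟩ := exists_nat_ge (C / (ε / 2))
  refine ⟨k + (N₁ + N₂), fun n hn => ?_⟩
  obtain ⟨j, rfl⟩ : ∃ j, n = k + j := ⟨n - k, by omega⟩
  refine ⟨markovProb μ k j, markovProb_nonneg k j, sum_markovProb_le_one hmp k j, ?_⟩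
  refine le_trans ?_ (hN₁ j (by omega))
  refine ENNReal.toReal_mono (measure_ne_top _ _) (measure_mono_ae ?_)
  filter_upwards [ae_blockProb_block_shift_iterate_ne_zero hmp] with w hw hlt
  change ε / 2 / 2 ≤ |_|
  change markovProb μ k j (block (letter S) (k + j) w) < _ at hlt
  obtain ⟨hne, hlog⟩ := neg_logb_markovProb k j w hw
  have hpos := (markovProb_nonneg k j (block (letter S) (k + j) w)).lt_of_ne hne.symm
  by_contra! habs
  have havg := (abs_lt.1 habs).2
  have hlt' := (Real.logb_lt_iff_lt_rpow one_lt_two hpos).2 hlt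
  have hCw : |Real.logb 2 (blockProb μ (letter S) k (block (letter S) k ((shift S)^[j] w)))| ≤ C :=
    Finset.single_le_sum (f := fun x => |Real.logb 2 (blockProb μ (letter S) k x)|)
      (fun _ _ => abs_nonneg _) (Finset.mem_univ _)
  have hCw' := (abs_le.1 hCw).1
  have hjC : C ≤ j * (ε / 2) := by
    have : (N₂ : ℝ) ≤ j := by exact_mod_cast (by omega : N₂ ≤ j)
    rw [← div_le_iff₀ (half_pos hε)]
    exact hN₂.trans this
  have hsum : birkhoffSum (shift S) (transitionInfo μ k) j w =
      j * birkhoffAverage ℝ (shift S) (transitionInfo μ k) j w := by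
    rcases Nat.eq_zero_or_pos j with rfl | hj
    · simp [birkhoffSum_zero]
    · have : (j : ℝ) ≠ 0 := by exact_mod_cast hj.ne'
      rw [birkhoffAverage, smul_eq_mul, mul_inv_cancel_left₀ this]
  have hj0 : (0 : ℝ) ≤ j := j.cast_nonneg
  have hup : (j : ℝ) * birkhoffAverage ℝ (shift S) (transitionInfo μ k) j w ≤ j * (H + ε / 2) :=
    mul_le_mul_of_nonneg_left (by linarith) hj0
  push_cast at hlt'
  have hk0 : 0 ≤ (k : ℝ) * (H + ε) := by positivity
  nlinarith

end Markov

/-! ### Sizes of probable sets of words -/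

section Typical

variable {S : Type*} [Fintype S] [MeasurableSpace S] [MeasurableSingletonClass S]
  {μ : Measure (ℕ → S)} [IsProbabilityMeasure μ]

/-- Achievability: about `2 ^ (n H)` words carry almost all the probability. -/
theorem exists_finset_card_le (hμ : Ergodic (shift S) μ) {ε δ : ℝ} (hε : 0 < ε) (hδ : 0 < δ) :
    ∃ N : ℕ, ∀ n, N ≤ n → ∃ A : Finset (Fin n → S),
      (A.card : ℝ) ≤ 2 ^ (n * (entropyRate μ (letter S) + ε)) ∧
      μ.real {w | block (letter S) n w ∉ A} ≤ δ := by
  classical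
  obtain ⟨N, hN⟩ := exists_subprobability_eventually_large hμ hε hδ
  refine ⟨N, fun n hn => ?_⟩
  obtain ⟨r, hr0, hr1, hr⟩ := hN n hn
  set t : ℝ := n * (entropyRate μ (letter S) + ε)
  refine ⟨Finset.univ.filter fun x => 2 ^ (-t) ≤ r x, ?_, by simpa using hr⟩
  set A := Finset.univ.filter fun x => 2 ^ (-t) ≤ r x with hA
  have h : (A.card : ℝ) * 2 ^ (-t) ≤ 1 := by
    rw [← nsmul_eq_mul]
    refine (Finset.card_nsmul_le_sum A r _ fun x hx => (Finset.mem_filter.1 hx).2).trans ?_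
    exact (Finset.sum_le_univ_sum_of_nonneg hr0).trans hr1
  rwa [Real.rpow_neg two_pos.le, ← div_eq_mul_inv, div_le_one (by positivity)] at h

/-- Converse: sets with exponentially fewer than `2 ^ (n H)` words have small probability. A set `B`
of larger probability would allow a description of the block with fewer than `n H` bits on average,
since outside `B` the typical words cost little more than `n H` bits and the rest is unlikely. -/
theorem measureReal_le_of_card_le (hμ : Ergodic (shift S) μ) {ε δ : ℝ} (hε : 0 < ε) (hδ : 0 < δ) :
    ∃ N : ℕ, ∀ n, N ≤ n → ∀ B : Finset (Fin n → S),
      (B.card : ℝ) ≤ 2 ^ (n * (entropyRate μ (letter S) - ε)) →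
      μ.real {w | block (letter S) n w ∈ B} ≤ δ := by
  classical
  have hmp := hμ.toMeasurePreserving
  set H := entropyRate μ (letter S) with hH
  obtain ⟨w₀⟩ : Nonempty (ℕ → S) := nonempty_of_isProbabilityMeasure μ
  have hS1 : (1 : ℝ) ≤ Fintype.card S := by
    have : Nonempty S := ⟨w₀ 0⟩
    exact_mod_cast Fintype.card_pos
  set s : ℝ := Real.logb 2 (Fintype.card S) with hs
  have hs0 : 0 ≤ s := Real.logb_nonneg one_lt_two hS1
  -- The slack `ε * δ` is shared between the excess `ε'` of the typical words, the cost `η * s` of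
  -- the untypical ones, and the cost `logb 2 3` of naming one of the three classes.
  set ε' : ℝ := ε * δ / 3 with hε'
  have hε'0 : 0 < ε' := by positivity
  set η : ℝ := ε * δ / (3 * (s + 1)) with hη
  have hη0 : 0 < η := by positivity
  have hηs : η * s ≤ ε * δ / 3 := by
    have : η * (s + 1) = ε * δ / 3 := by rw [hη]; field_simp
    nlinarith
  obtain ⟨N₁, hN₁⟩ := exists_subprobability_eventually_large hμ hε'0 hη0
  obtain ⟨N₂, hN₂⟩ := exists_nat_ge (Real.logb 2 3 / (ε * δ / 3))
  refine ⟨N₁ + N₂ + 1, fun n hn B hB => ?_⟩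
  obtain ⟨q, hq0, hq1, hq⟩ := hN₁ n (by omega)
  set p := blockProb μ (letter S) n with hp
  have hn0 : (0 : ℝ) < n := by exact_mod_cast (by omega : 0 < n)
  -- The code length, without the `logb 2 3` bits that name the class.
  let len : (Fin n → S) → ℝ := fun x =>
    if x ∈ B then n * (H - ε) else if 2 ^ (-(n * (H + ε'))) ≤ q x then n * (H + ε') else n * s
  let r : (Fin n → S) → ℝ := fun x => 2 ^ (-len x) / 3
  have hrpos : ∀ x, 0 < r x := fun x => by positivity
  have hrle : ∀ x, r x ≤ ((if x ∈ B then (2 : ℝ) ^ (-(n * (H - ε))) else 0) + q x +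
      2 ^ (-(n * s))) / 3 := by
    intro x
    have h1 := hq0 x
    have h2 : (0 : ℝ) < 2 ^ (-(n * s)) := by positivity
    simp only [r, len]
    refine div_le_div_of_nonneg_right ?_ (by norm_num)
    split_ifs with hxB hxq <;> linarith
  have hcardS : (Fintype.card (Fin n → S) : ℝ) * 2 ^ (-(n * s)) = 1 := by
    have e : (2 : ℝ) ^ (n * s) = (Fintype.card S : ℝ) ^ n := by
      rw [mul_comm, Real.rpow_mul two_pos.le, hs, Real.rpow_logb two_pos (by norm_num)
        (by linarith), Real.rpow_natCast]
    rw [Real.rpow_neg two_pos.le, e, Fintype.card_fun, Fintype.card_fin]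
    push_cast
    exact mul_inv_cancel₀ (by positivity)
  have hBsum : ∑ x, (if x ∈ B then (2 : ℝ) ^ (-(n * (H - ε))) else 0) ≤ 1 := by
    rw [Finset.sum_ite_mem, Finset.univ_inter, Finset.sum_const, nsmul_eq_mul,
      Real.rpow_neg two_pos.le, ← div_eq_mul_inv]
    exact (div_le_one (by positivity)).2 hB
  have hrsum : ∑ x, r x ≤ ∑ x, p x := by
    rw [sum_blockProb]
    refine (Finset.sum_le_sum fun x _ => hrle x).trans ?_
    rw [← Finset.sum_div, Finset.sum_add_distrib, Finset.sum_add_distrib, Finset.sum_const,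
      nsmul_eq_mul, Finset.card_univ, hcardS]
    linarith
  have hG := neg_sum_mul_logb_le (p := p) (r := r) (fun x => blockProb_nonneg _ x)
    (fun x => (hrpos x).le) hrsum fun x _ => (hrpos x).ne'
  have hlogr : ∀ x, Real.logb 2 (r x) = -len x - Real.logb 2 3 := fun x => by
    simp only [r]
    rw [Real.logb_div (by positivity) (by norm_num), Real.logb_rpow two_pos (by norm_num)]
  have hent : n * H ≤ (∑ x, p x * len x) + Real.logb 2 3 := by
    refine (mul_entropyRate_le_blockEntropy hmp n).trans (hG.trans (le_of_eq ?_))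
    simp only [hlogr, mul_sub, mul_neg, Finset.sum_sub_distrib, Finset.sum_neg_distrib,
      ← Finset.sum_mul, hp, sum_blockProb]
    ring
  set b : ℝ := μ.real {w | block (letter S) n w ∈ B} with hb
  set U := Finset.univ.filter fun x => q x < 2 ^ (-(n * (H + ε'))) with hU
  have hUη : ∑ x ∈ U, p x ≤ η := by
    rw [← measureReal_comp_block]
    simpa [hU] using hq
  have hbsum : b = ∑ x ∈ B, p x := measureReal_comp_block n B
  have hH0 : 0 ≤ H := entropyRate_nonneg hmp
  have hlen : ∀ x, len x ≤ n * (H + ε') - (if x ∈ B then n * ε else 0) +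
      (if x ∈ U then n * s else 0) := by
    intro x
    have e1 : 0 ≤ n * ε' := by positivity
    have e2 : 0 ≤ n * s := by positivity
    have e3 : 0 ≤ n * H := by positivity
    simp only [len, hU, Finset.mem_filter, Finset.mem_univ, true_and]
    split_ifs <;> linarith
  have hsumlen : ∑ x, p x * len x ≤ n * (H + ε') - n * ε * b + n * s * η := by
    have hterm : ∀ x, p x * len x ≤ p x * (n * (H + ε')) - (if x ∈ B then p x else 0) * (n * ε) +
        (if x ∈ U then p x else 0) * (n * s) := by
      intro x
      refine (mul_le_mul_of_nonneg_left (hlen x) (blockProb_nonneg n x)).trans (le_of_eq ?_)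
      split_ifs <;> ring
    refine (Finset.sum_le_sum fun x _ => hterm x).trans ?_
    rw [Finset.sum_add_distrib, Finset.sum_sub_distrib, ← Finset.sum_mul, ← Finset.sum_mul,
      ← Finset.sum_mul, Finset.sum_ite_mem, Finset.sum_ite_mem, Finset.univ_inter,
      Finset.univ_inter, ← hbsum, hp, sum_blockProb, ← hp]
    have := mul_le_mul_of_nonneg_right hUη (by positivity : 0 ≤ n * s)
    linarith
  have h3 : Real.logb 2 3 ≤ n * (ε * δ / 3) := by
    have : (N₂ : ℝ) ≤ n := by exact_mod_cast (by omega : N₂ ≤ n)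
    rw [← div_le_iff₀ (by positivity)]
    exact hN₂.trans this
  have hfin : n * (ε * b) ≤ n * (ε * δ) := by
    have h4 := mul_le_mul_of_nonneg_left hηs hn0.le
    have h5 : n * (H + ε') = n * H + n * (ε * δ / 3) := by rw [hε']; ring
    linarith
  exact le_of_mul_le_mul_left (le_of_mul_le_mul_left hfin hn0) hε

end Typical

/-! ### Predictors -/

theorem card_eq_two_rpow_bitBudget (Z : Type*) [Fintype Z] [Nonempty Z] (q : ℕ) :
    (Fintype.card (Fin q → Z) : ℝ) = 2 ^ bitBudget Z q := by
  have hZ : (0 : ℝ) < Fintype.card Z := by exact_mod_cast Fintype.card_pos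
  rw [bitBudget, Real.rpow_logb two_pos (by norm_num) (by positivity)]
  simp

/-- A set of inputs no larger than the embedding space is recovered exactly by some predictor. -/
theorem exists_encoderDecoder {S Z V : Type*} [Fintype Z] [Nonempty Z] {n q d : ℕ}
    [Nonempty (Fin n → S)] (g : (Fin n → S) → (Fin d → V)) (A : Finset (Fin n → S))
    (hA : A.card ≤ Fintype.card (Fin q → Z)) :
    ∃ h : EncoderDecoder S Z V n q d, ∀ x ∈ A, h.predict x = g x := by
  classical
  obtain ⟨e, he⟩ : ∃ e : (Fin n → S) → (Fin q → Z), Set.InjOn e A := by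
    obtain ⟨e⟩ : Nonempty (A ↪ (Fin q → Z)) :=
      Function.Embedding.nonempty_of_card_le (by simpa using hA)
    refine ⟨fun x => if hx : x ∈ A then e ⟨x, hx⟩ else Classical.arbitrary _, ?_⟩
    intro x hx y hy hxy
    rw [Finset.mem_coe] at hx hy
    simp only [dif_pos hx, dif_pos hy] at hxy
    exact congrArg Subtype.val (e.injective hxy)
  refine ⟨⟨e, fun z => g (Function.invFunOn e A z)⟩, fun x hx => ?_⟩
  exact congrArg g (he.leftInvOn_invFunOn (Finset.mem_coe.2 hx))

/-- A predictor with an injective target is correct on at most as many inputs as there are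
embeddings. -/
theorem card_filter_predict_eq_le {S Z V : Type*} [Fintype S] [Fintype Z] [DecidableEq (Fin d → V)]
    {n q : ℕ} {g : (Fin n → S) → (Fin d → V)} (hg : Function.Injective g)
    (h : EncoderDecoder S Z V n q d) :
    (Finset.univ.filter fun x => h.predict x = g x).card ≤ Fintype.card (Fin q → Z) := by
  rw [← Finset.card_univ]
  refine Finset.card_le_card_of_injOn h.encoder (fun _ _ => Finset.mem_coe.2 (Finset.mem_univ _)) ?_
  intro x hx y hy hxy
  simp only [Finset.coe_filter, Finset.mem_univ, true_and, Set.mem_ofPred_eq] at hx hy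
  apply hg
  rw [← hx, ← hy, EncoderDecoder.predict, EncoderDecoder.predict, hxy]

theorem generalizationError_le_errorProb {Ω S Z V : Type*} [MeasurableSpace Ω] {P : Measure Ω}
    [IsProbabilityMeasure P] [Fintype S] [MeasurableSpace S] [MeasurableSingletonClass S]
    {X : ℕ → Ω → S} (hX : ∀ i, Measurable (X i)) {n q d : ℕ}
    {l : (Fin d → V) → (Fin d → V) → ℝ} (hl : IsLoss l) (g : (Fin n → S) → (Fin d → V))
    (h : EncoderDecoder S Z V n q d) :
    generalizationError P X l g h ≤ errorProb P X g h := by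
  have hm : MeasurableSet {ω | h.predict (block X n ω) ≠ g (block X n ω)} :=
    measurable_block hX n (Set.toFinite {x | h.predict x ≠ g x}).measurableSet
  rw [generalizationError, errorProb, ← integral_indicator_one hm]
  refine integral_mono_of_nonneg (ae_of_all _ fun ω => hl.nonneg _ _)
    ((integrable_const (1 : ℝ)).indicator hm) (ae_of_all _ fun ω => ?_)
  by_cases hω : h.predict (block X n ω) = g (block X n ω)
  · simp [hω, hl.self]
  · simpa [Set.indicator_apply, hω] using hl.le_one _ _

end EmbeddingRate

theorem theorem3 {Ω S : Type*} [MeasurableSpace Ω] (P : Measure Ω) [IsProbabilityMeasure P]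
    [Fintype S] [MeasurableSpace S] [MeasurableSingletonClass S]
    (X : ℕ → Ω → S) (hX : IsStationaryErgodic P X) :
    -- the entropy rate is a genuine limit
    Tendsto (fun n : ℕ => blockEntropy P X n / n) atTop (𝓝 (entropyRate P X)) ∧
    -- achievability
    (∀ ε : ℝ, 0 < ε → ∀ δ : ℝ, 0 < δ → ∃ N : ℕ, ∀ n : ℕ, N ≤ n →
      ∀ (V : Type*) [Finite V] (d : ℕ) (g : (Fin n → S) → (Fin d → V)), Function.Injective g →
      ∀ (Z : Type*) [Fintype Z] [Nonempty Z] (q : ℕ),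
        (n : ℝ) * (entropyRate P X + ε) ≤ bitBudget Z q →
      ∀ m : ℕ, ∃ A : Trainer S Z V n q d m, ∀ Ψ : SampleList S V n d m, IsTrainingSet g Ψ →
        errorProb P X g (A Ψ) ≤ δ ∧
        ∀ l : (Fin d → V) → (Fin d → V) → ℝ, IsLoss l →
          generalizationError P X l g (A Ψ) ≤ δ) ∧
    -- converse
    (∀ ε : ℝ, 0 < ε → ∀ δ : ℝ, 0 < δ → ∃ N : ℕ, ∀ n : ℕ, N ≤ n →
      ∀ (V : Type*) [Finite V] (d : ℕ) (g : (Fin n → S) → (Fin d → V)), Function.Injective g →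
      ∀ (Z : Type*) [Fintype Z] [Nonempty Z] (q : ℕ),
        embeddingRate Z q n < entropyRate P X - ε →
      ∀ (m : ℕ) (A : Trainer S Z V n q d m) (Ψ : SampleList S V n d m), IsTrainingSet g Ψ →
        1 - δ ≤ errorProb P X g (A Ψ)) := by

  have hmeas := hX.measurable_letter
  set μ := P.map fun ω i => X i ω with hμdef
  have hprob : IsProbabilityMeasure μ :=
    Measure.isProbabilityMeasure_map (measurable_pi_lambda _ hmeas).aemeasurable
  have hμ : Ergodic (shift S) μ := hX.ergodic_shift
  have hrate : entropyRate P X = entropyRate μ (letter S) := by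
    simp only [entropyRate, blockEntropy_eq_map hmeas]
    rfl
  obtain ⟨ω₀⟩ : Nonempty Ω := nonempty_of_isProbabilityMeasure P
  refine ⟨?_, ?_, ?_⟩
  · rw [hrate]
    simpa only [blockEntropy_eq_map hmeas] using tendsto_blockEntropy_div hμ.toMeasurePreserving
  · intro ε hε δ hδ
    obtain ⟨N, hN⟩ := exists_finset_card_le hμ hε hδ
    refine ⟨N, fun n hn V _ d g _ Z _ _ q hq m => ?_⟩
    obtain ⟨A, hA, hAδ⟩ := hN n hn
    have hcard : A.card ≤ Fintype.card (Fin q → Z) := by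
      have h : (A.card : ℝ) ≤ Fintype.card (Fin q → Z) := by
        rw [card_eq_two_rpow_bitBudget]
        refine hA.trans (Real.rpow_le_rpow_of_exponent_le one_le_two ?_)
        rwa [hrate] at hq
      exact_mod_cast h
    have : Nonempty (Fin n → S) := ⟨block X n ω₀⟩
    obtain ⟨h, hh⟩ := exists_encoderDecoder g A hcard
    have herr : errorProb P X g h ≤ δ := by
      rw [← measureReal_block_eq_map hmeas n (· ∉ A)] at hAδ
      refine le_trans (measureReal_mono fun ω hω => ?_) hAδ
      exact fun hmem => hω (hh _ hmem)
    exact ⟨fun _ => h, fun Ψ _ => ⟨herr, fun l hl =>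
      (generalizationError_le_errorProb hmeas hl g h).trans herr⟩⟩
  · intro ε hε δ hδ
    obtain ⟨N, hN⟩ := measureReal_le_of_card_le hμ hε hδ
    refine ⟨N + 1, fun n hn V _ d g hg Z _ _ q hq m A Ψ _ => ?_⟩
    classical
    set h := A Ψ
    have hn0 : (0 : ℝ) < n := by exact_mod_cast (by omega : 0 < n)
    set B := Finset.univ.filter fun x => h.predict x = g x with hB
    have hcard : (B.card : ℝ) ≤ 2 ^ (n * (entropyRate μ (letter S) - ε)) := by
      refine (Nat.cast_le.2 (card_filter_predict_eq_le hg h)).trans ?_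
      rw [card_eq_two_rpow_bitBudget]
      refine Real.rpow_le_rpow_of_exponent_le one_le_two ?_
      rw [embeddingRate, hrate, div_lt_iff₀ hn0] at hq
      linarith
    have hBδ := hN n (by omega) B hcard
    rw [← measureReal_block_eq_map hmeas n (· ∈ B)] at hBδ
    have hmB : MeasurableSet {ω | block X n ω ∈ B} := measurable_block hmeas n B.measurableSet
    have hcompl : {ω | h.predict (block X n ω) ≠ g (block X n ω)} = {ω | block X n ω ∈ B}ᶜ := by
      ext ω
      simp [hB]
    rw [errorProb, hcompl, probReal_compl_eq_one_sub hmB]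
    linarith
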